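/- Let $n,d\in\mathbb N$ with $n>1$, let $m_1,\dots,m_n>0$, $p_1,\dots,p_n>0$ and $E\in\mathbb R^d$. Let $W:\mathbb R^d\to\mathbb R^{n\times n}$ satisfy: (W1) $W(z)$ is a symmetric matrix for every $z$; (W2) $W_{ij}\in C^1(\mathbb R^d;\mathbb R)$ for all $i,j$; (W3) $W(z)=W(-z)$ for every $z$; (W4) there is a matrix $\overline W\in\mathbb R^{n\times n}$ with $|W_{ij}(z)|\le\overline W_{ij}(1+|z|^2)$ for all $i,j,z$; (W5) $\kappa\in\mathbb R^{n\times n}$ is a symmetric matrix such that $z\mapsto W_{ij}(z)-\tfrac12\kappa_{ij}|z|^2$ is convex for all $i,j$. Assume that the system is irreducible, i.e. the graph on $\{1,\dots,n\}$ with edges $\{(i,j):\nabla W_{ij}\not\equiv0\text{ on }\mathbb R^d\}$ is connected. Let $\mathscr P$ be the set of $n$-vectors $\mu=(\mu_1,\dots,\mu_n)$ of (positive) Borel measures on $\mathbb R^d$ with $\mu_j(\mathbb R^d)=p_j$, $\int|x|^2\,d\mu_j<\infty$ for all $j$, and $\sum_{j}\frac1{m_j}\int x\,d\mu_j(x)=E$.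 It carries the distance $\mathbf W_{\mathscr P}(\mu,\nu)=\big[\sum_j\frac1{m_j}\inf_{\gamma\in\Gamma(\mu_j,\nu_j)}\int|x-y|^2\,d\gamma(x,y)\big]^{1/2}$, where $\Gamma(\mu_j,\nu_j)$ is the set of Borel measures on $\mathbb R^d\times\mathbb R^d$ with marginals $\mu_j,\nu_j$. For $\mu\in\mathscr P$ put $$\mathcal W(\mu)=\frac12\sum_{i,j=1}^n\int\!\!\int W_{ij}(x-y)\,d\mu_i(x)\,d\mu_j(y).$$ For $\lambda\in\mathbb R$, a functional $\mathfrak A:\mathscr P\to\mathbb R$ is called $\lambda$-convex along generalized geodesics on $(\mathscr P,\mathbf W_{\mathscr P})$ if for all $\mu^1,\mu^2,\mu^3\in\mathscr P$ there is an $n$-vector $\boldsymbol\mu=(\boldsymbol\mu_1,\dots,\boldsymbol\mu_n)$ of Borel measures on $\mathbb R^d\times\mathbb R^d\times\mathbb R^d$ such that, for all $j$: the $k$-th marginal of $\boldsymbol\mu_j$ is $\mu^k_j$ for $k=1,2,3$; for $k=2,3$ the marginal $\pi^{(1,k)}{}_\#\boldsymbol\mu_j$ minimizes $\int|x-y|^2\,d\gamma$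 over $\gamma\in\Gamma(\mu_j^1,\mu_j^k)$; and, with $\mu_{s,j}:=[(1-s)\pi^2+s\pi^3]_\#\boldsymbol\mu_j$, for every $s\in[0,1]$ one has $\mu_s\in\mathscr P$ and $$\mathfrak A(\mu_s)\le(1-s)\mathfrak A(\mu^2)+s\mathfrak A(\mu^3)-\frac\lambda2 s(1-s)\sum_{j=1}^n\frac1{m_j}\int|x^3-x^2|^2\,d\boldsymbol\mu_j(x^1,x^2,x^3).$$ Set $\eta_i:=\min_{j\ne i}\kappa_{ij}m_j$ and $$\lambda_0:=\min_{1\le i\le n}\Big[p_i\min(0,m_i\kappa_{ii}-\eta_i)+\frac12\sum_{j=1}^n p_j\Big(\eta_j+\eta_i\frac{m_i}{m_j}\Big)\Big].$$ Theorem. The integrals defining $\mathcal W$ converge absolutely on $\mathscr P$, i.e. $(x,y)\mapsto W_{ij}(x-y)$ is $\mu_i\otimes\mu_j$-integrable for all $\mu\in\mathscr P$ and all $i,j$; and for every $\lambda\le\lambda_0$, $\mathcal W$ is $\lambda$-convex along generalized geodesics on $(\mathscr P,\mathbf W_{\mathscr P})$. -/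

import Mathlib

open MeasureTheory

noncomputable section

namespace MultiSpecies

/-- The Euclidean space `ℝ^d`. -/
abbrev Rd (d : ℕ) : Type := EuclideanSpace ℝ (Fin d)

/-- `n`-vectors of (positive) Borel measures on `ℝ^d`. -/
abbrev VecMeasure (n d : ℕ) : Type := Fin n → Measure (Rd d)

/-- The standing assumptions on a matrix-valued interaction potential `W : ℝ^d → ℝ^{n×n}`,
with matrix `κ` of semi-convexity constants. -/
structure IsInteractionPotential {n d : ℕ} (W : Rd d → Matrix (Fin n) (Fin n) ℝ)
    (κ : Matrix (Fin n) (Fin n) ℝ) : Prop where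
  symm : ∀ z, (W z).IsSymm
  contDiff : ∀ i j, ContDiff ℝ 1 (fun z => W z i j)
  even : ∀ z, W z = W (-z)
  growth : ∃ Wbar : Matrix (Fin n) (Fin n) ℝ,
    ∀ i j z, |W z i j| ≤ Wbar i j * (1 + ‖z‖ ^ 2)
  kappa_symm : κ.IsSymm
  semiconvex : ∀ i j, ConvexOn ℝ Set.univ (fun z => W z i j - 1 / 2 * κ i j * ‖z‖ ^ 2)

/-- The interaction graph on `{1, …, n}`: distinct `i`, `j` are joined iff `∇W_ij` or `∇W_ji`
does not vanish identically (`W_ij = W_ji` for the potentials considered; loops do not affect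
connectedness). -/
def interactionGraph {n d : ℕ} (W : Rd d → Matrix (Fin n) (Fin n) ℝ) : SimpleGraph (Fin n) :=
  SimpleGraph.fromRel (fun i j => ∃ z, gradient (fun z => W z i j) z ≠ 0)

/-- The system with interaction potential `W` is irreducible. -/
def Irreducible {n d : ℕ} (W : Rd d → Matrix (Fin n) (Fin n) ℝ) : Prop :=
  (interactionGraph W).Connected

/-- The space `𝒫` of `n`-vectors of Borel measures with total masses `p_j`, finite second moments,
and joint weighted centre of mass `∑ j, (1 / m_j) ∫ x dμ_j = c`. -/
structure InSpace {n d : ℕ} (m p : Fin n → ℝ) (c : Rd d) (μ : VecMeasure n d) : Prop where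
  mass : ∀ j, μ j Set.univ = ENNReal.ofReal (p j)
  moment : ∀ j, ∫⁻ x, ‖x‖ₑ ^ 2 ∂(μ j) < ⊤
  center : ∑ j, (1 / m j) • ∫ x, x ∂(μ j) = c

/-- The multi-component interaction energy
`𝒲(μ) = 1/2 ∑ i, ∑ j, ∫∫ W_ij(x - y) dμ_i(x) dμ_j(y)`. -/
def energy {n d : ℕ} (W : Rd d → Matrix (Fin n) (Fin n) ℝ) (μ : VecMeasure n d) : ℝ :=
  1 / 2 * ∑ i, ∑ j, ∫ y, ∫ x, W (x - y) i j ∂(μ i) ∂(μ j)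

/-- `Γ(μ, ν)`: the Borel measures on `ℝ^d × ℝ^d` with marginals `μ` and `ν`. -/
def couplings {d : ℕ} (μ ν : Measure (Rd d)) : Set (Measure (Rd d × Rd d)) :=
  {γ | γ.map Prod.fst = μ ∧ γ.map Prod.snd = ν}

/-- The quadratic cost `∫ |x - y|² dγ(x, y)` of a plan. -/
def quadCost {d : ℕ} (γ : Measure (Rd d × Rd d)) : ENNReal :=
  ∫⁻ z, ‖z.1 - z.2‖ₑ ^ 2 ∂γ

/-- `γ` realizes the minimum of the quadratic cost over `Γ(μ, ν)`. -/
def IsOptimalPlan {d : ℕ} (μ ν : Measure (Rd d)) (γ : Measure (Rd d × Rd d)) : Prop :=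
  γ ∈ couplings μ ν ∧ ∀ γ' ∈ couplings μ ν, quadCost γ ≤ quadCost γ'

/-- The curve `μ_{s,j} = [(1 - s) π² + s π³]_# M_j` induced by an `n`-vector `M` of measures on
`ℝ^d × ℝ^d × ℝ^d`. -/
def genGeodesic {n d : ℕ} (M : Fin n → Measure (Rd d × Rd d × Rd d)) (s : ℝ) : VecMeasure n d :=
  fun j => (M j).map (fun x => (1 - s) • x.2.1 + s • x.2.2)

/-- `λ`-convexity along generalized geodesics on the space `𝒫`, for a real-valued functional `F`.
Only values of `F` on `𝒫` enter. -/
def ConvexAlongGenGeodesics {n d : ℕ} (m p : Fin n → ℝ) (c : Rd d)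
    (lam : ℝ) (F : VecMeasure n d → ℝ) : Prop :=
  ∀ μ₁ μ₂ μ₃ : VecMeasure n d, InSpace m p c μ₁ → InSpace m p c μ₂ → InSpace m p c μ₃ →
    ∃ M : Fin n → Measure (Rd d × Rd d × Rd d),
      (∀ j, (M j).map (fun x => x.1) = μ₁ j ∧
        (M j).map (fun x => x.2.1) = μ₂ j ∧
        (M j).map (fun x => x.2.2) = μ₃ j) ∧
      (∀ j, IsOptimalPlan (μ₁ j) (μ₂ j) ((M j).map (fun x => (x.1, x.2.1))) ∧
        IsOptimalPlan (μ₁ j) (μ₃ j) ((M j).map (fun x => (x.1, x.2.2)))) ∧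
      ∀ s ∈ Set.Icc (0 : ℝ) 1,
        InSpace m p c (genGeodesic M s) ∧
        F (genGeodesic M s) ≤ (1 - s) * F μ₂ + s * F μ₃
          - lam / 2 * s * (1 - s) * ∑ j, 1 / m j * ∫ x, ‖x.2.2 - x.2.1‖ ^ 2 ∂(M j)

/-- `η_i = min_{j ≠ i} κ_ij m_j` (for `n > 1`: the infimum of a finite non-empty family). -/
def eta {n : ℕ} (m : Fin n → ℝ) (κ : Matrix (Fin n) (Fin n) ℝ) (i : Fin n) : ℝ :=
  ⨅ j : {j : Fin n // j ≠ i}, κ i j * m j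

/-- `λ₀ = min_i [p_i min(0, m_i κ_ii - η_i) + 1/2 ∑ j, p_j (η_j + η_i m_i / m_j)]`
(for `n > 0`: the infimum of a finite non-empty family). -/
def lambdaZero {n : ℕ} (m p : Fin n → ℝ) (κ : Matrix (Fin n) (Fin n) ℝ) : ℝ :=
  ⨅ i, (p i * min 0 (m i * κ i i - eta m κ i)
    + 1 / 2 * ∑ j, p j * (eta m κ j + eta m κ i * (m i / m j)))

end MultiSpecies

end

/-! The energy estimate holds for every triple coupling with the prescribed marginals; optimality is
needed only to satisfy the definition of a generalized geodesic. Such couplings come from the direct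
method (`exists_isOptimalPlan`) and from gluing two optimal plans along their common first marginal
(`exists_gluing`).

Put u = x³ - x², A_j = ∫|u|² dM_j, B_j = ∫u dM_j, D_ij = ∬|u(x) - u(y)|² dM_i dM_j. Integrating the
semi-convexity of W_ij (`energy_interpolate_le`) leaves a gain of s(1-s)/2 times ½ Σ κ_ij D_ij. It
remains to show λ Σ A_j/m_j ≤ ½ Σ κ_ij D_ij (`lambdaZero_mul_le`).

Here D_ij = p_j A_i + p_i A_j - 2⟨B_i, B_j⟩, and Σ B_j/m_j = 0 because both ends share the weighted
centre of mass. Replacing κ_ij by the smaller η_i/m_j off the diagonal makes the cross terms vanish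
after summation over j, and λ₀ is read off from the coefficients of A_i/m_i. -/

namespace MultiSpecies

/-! ### Existence of optimal plans and gluing. -/

open ProbabilityTheory Filter Topology
open scoped ENNReal NNReal BoundedContinuousFunction

/-- By monotone convergence the integral is the supremum over k of the integrals of min(f, k), each
weakly continuous because the integrand is bounded and continuous. -/
lemma lowerSemicontinuous_lintegral_finiteMeasure {Ω : Type*} [MeasurableSpace Ω]
    [TopologicalSpace Ω] [OpensMeasurableSpace Ω] {f : Ω → ℝ≥0} (hf : Continuous f) :
    LowerSemicontinuous fun γ : FiniteMeasure Ω => ∫⁻ x, (f x : ℝ≥0∞) ∂(γ : Measure Ω) := by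
  have key : (fun γ : FiniteMeasure Ω => ∫⁻ x, (f x : ℝ≥0∞) ∂(γ : Measure Ω)) =
      fun γ : FiniteMeasure Ω => ⨆ k : ℕ, ∫⁻ x, ((min (f x) (k : ℝ≥0) : ℝ≥0) : ℝ≥0∞)
        ∂(γ : Measure Ω) := by
    funext γ
    rw [← lintegral_iSup]
    · congr 1
      funext x
      refine le_antisymm ?_ (iSup_le fun k => by exact_mod_cast min_le_left _ _)
      obtain ⟨k, hk⟩ := exists_nat_ge (f x)
      refine le_iSup_of_le k ?_
      rw [min_eq_left hk]
    · intro k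
      exact (hf.min continuous_const).measurable.coe_nnreal_ennreal
    · intro k l hkl x
      have : (k : ℝ≥0) ≤ l := by exact_mod_cast hkl
      exact ENNReal.coe_le_coe.2 (min_le_min_left _ this)
  rw [key]
  refine lowerSemicontinuous_iSup fun k => Continuous.lowerSemicontinuous ?_
  let g : Ω →ᵇ ℝ≥0 := BoundedContinuousFunction.mkOfBound
    ⟨fun x => min (f x) (k : ℝ≥0), hf.min continuous_const⟩ k (by
      intro x y
      simp only [ContinuousMap.coe_mk]
      rw [NNReal.dist_eq, abs_le]
      have h1 : ((min (f x) (k : ℝ≥0) : ℝ≥0) : ℝ) ≤ k := by exact_mod_cast min_le_right _ _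
      have h2 : ((min (f y) (k : ℝ≥0) : ℝ≥0) : ℝ) ≤ k := by exact_mod_cast min_le_right _ _
      have h3 := NNReal.coe_nonneg (min (f x) (k : ℝ≥0))
      have h4 := NNReal.coe_nonneg (min (f y) (k : ℝ≥0))
      constructor <;> linarith)
  exact continuous_iff_continuousAt.2 fun γ =>
    FiniteMeasure.tendsto_iff_forall_lintegral_tendsto.1 tendsto_id g

lemma prod_smul_mem_couplings {d : ℕ} {μ ν : Measure (Rd d)} [IsFiniteMeasure μ]
    [IsFiniteMeasure ν] (hμν : μ Set.univ = ν Set.univ) (h0 : μ Set.univ ≠ 0) :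
    (μ Set.univ)⁻¹ • μ.prod ν ∈ couplings μ ν := by
  have hc : (μ Set.univ)⁻¹ * μ Set.univ = 1 := ENNReal.inv_mul_cancel h0 (measure_ne_top _ _)
  constructor
  · rw [Measure.map_smul, Measure.map_fst_prod, smul_smul, ← hμν, hc, one_smul]
  · rw [Measure.map_smul, Measure.map_snd_prod, smul_smul, hc, one_smul]

lemma isTightMeasureSet_couplings {d : ℕ} (μ ν : Measure (Rd d)) [IsFiniteMeasure μ]
    [IsFiniteMeasure ν] : IsTightMeasureSet (couplings μ ν) := by
  refine IsTightMeasureSet.prodMk ?_ ?_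
  · refine (isTightMeasureSet_singleton (μ := μ)).subset ?_
    rintro _ ⟨γ, hγ, rfl⟩
    exact hγ.1
  · refine (isTightMeasureSet_singleton (μ := ν)).subset ?_
    rintro _ ⟨γ, hγ, rfl⟩
    exact hγ.2

lemma measure_univ_of_mem_couplings {d : ℕ} {μ ν : Measure (Rd d)}
    {γ : Measure (Rd d × Rd d)} (hγ : γ ∈ couplings μ ν) : γ Set.univ = μ Set.univ := by
  rw [← hγ.1, Measure.map_apply measurable_fst MeasurableSet.univ, Set.preimage_univ]

/-- Prokhorov: tightness of the two marginals gives tightness of the plans, their mass is fixed, and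
the marginal constraints are closed since pushforward under a projection is weakly continuous. -/
theorem isCompact_finiteMeasure_couplings {d : ℕ} (μ ν : Measure (Rd d)) [IsFiniteMeasure μ]
    [IsFiniteMeasure ν] :
    IsCompact {γ : FiniteMeasure (Rd d × Rd d) | (γ : Measure (Rd d × Rd d)) ∈ couplings μ ν} := by
  obtain ⟨u, -, u_pos, u_lim⟩ :
      ∃ u : ℕ → ℝ≥0, StrictAnti u ∧ (∀ n, 0 < u n) ∧ Tendsto u atTop (𝓝 0) :=
    exists_seq_strictAnti_tendsto 0
  have htight := isTightMeasureSet_iff_exists_isCompact_measure_compl_le.1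
    (isTightMeasureSet_couplings μ ν)
  choose K hKc hK using fun n => htight (u n) (by exact_mod_cast u_pos n)
  let μ' : FiniteMeasure (Rd d) := ⟨μ, inferInstance⟩
  let ν' : FiniteMeasure (Rd d) := ⟨ν, inferInstance⟩
  have hcomp := isCompact_setOfPred_finiteMeasure_mass_eq_compl_isCompact_le
    (E := Rd d × Rd d) μ'.mass u_lim hKc (Or.inl inferInstance)
  have hclosed : IsClosed {γ : FiniteMeasure (Rd d × Rd d) |
      γ.map Prod.fst = μ' ∧ γ.map Prod.snd = ν'} :=
    (isClosed_eq (FiniteMeasure.continuous_map continuous_fst) continuous_const).inter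
      (isClosed_eq (FiniteMeasure.continuous_map continuous_snd) continuous_const)
  have hset : {γ : FiniteMeasure (Rd d × Rd d) |
      γ.map Prod.fst = μ' ∧ γ.map Prod.snd = ν'} =
      {γ : FiniteMeasure (Rd d × Rd d) | (γ : Measure (Rd d × Rd d)) ∈ couplings μ ν} := by
    ext γ
    exact and_congr Subtype.ext_iff Subtype.ext_iff
  rw [hset] at hclosed
  refine hcomp.of_isClosed_subset hclosed fun γ hγ => ⟨?_, fun n => ?_⟩
  · rw [FiniteMeasure.mass, FiniteMeasure.mass, ← ENNReal.coe_inj]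
    simpa [μ'] using measure_univ_of_mem_couplings hγ
  · have := hK n _ hγ
    rw [← ENNReal.coe_le_coe, FiniteMeasure.ennreal_coeFn_eq_coeFn_toMeasure]
    exact this

theorem exists_isOptimalPlan {d : ℕ} {μ ν : Measure (Rd d)} [IsFiniteMeasure μ]
    [IsFiniteMeasure ν] (hμν : μ Set.univ = ν Set.univ) (h0 : μ Set.univ ≠ 0) :
    ∃ γ, IsOptimalPlan μ ν γ := by
  have hfin {γ : Measure (Rd d × Rd d)} (hγ : γ ∈ couplings μ ν) : IsFiniteMeasure γ :=
    ⟨by rw [measure_univ_of_mem_couplings hγ]; exact measure_lt_top _ _⟩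
  have hmem := prod_smul_mem_couplings hμν h0
  have hcont : Continuous fun z : Rd d × Rd d => ‖z.1 - z.2‖₊ ^ 2 := by fun_prop
  obtain ⟨γ, hγ, hmin⟩ := LowerSemicontinuousOn.exists_isMinOn
    ⟨⟨_, hfin hmem⟩, hmem⟩ (isCompact_finiteMeasure_couplings μ ν)
    (lowerSemicontinuous_lintegral_finiteMeasure hcont |>.lowerSemicontinuousOn _)
  refine ⟨γ, hγ, fun γ' hγ' => ?_⟩
  have := isMinOn_iff.1 hmin ⟨γ', hfin hγ'⟩ hγ'
  simp only [ENNReal.coe_pow, ← enorm_eq_nnnorm] at this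
  exact this

/-- Disintegrate both plans over the common marginal on X and make the Y and Z coordinates
conditionally independent given X. -/
theorem exists_gluing {X Y Z : Type*} [MeasurableSpace X] [MeasurableSpace Y]
    [StandardBorelSpace Y] [Nonempty Y] [MeasurableSpace Z] [StandardBorelSpace Z] [Nonempty Z]
    (γ : Measure (X × Y)) (δ : Measure (X × Z)) [IsFiniteMeasure γ] [IsFiniteMeasure δ]
    (h : γ.fst = δ.fst) :
    ∃ M : Measure (X × Y × Z), M.map (fun x => (x.1, x.2.1)) = γ ∧
      M.map (fun x => (x.1, x.2.2)) = δ := by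
  refine ⟨γ.fst ⊗ₘ (γ.condKernel ×ₖ δ.condKernel), ?_, ?_⟩
  · have := Measure.compProd_map (μ := γ.fst) (κ := γ.condKernel ×ₖ δ.condKernel)
      (measurable_fst (α := Y) (β := Z))
    rw [← Kernel.fst_eq, Kernel.fst_prod, γ.disintegrate] at this
    exact this.symm
  · have := Measure.compProd_map (μ := γ.fst) (κ := γ.condKernel ×ₖ δ.condKernel)
      (measurable_snd (α := Y) (β := Z))
    rw [← Kernel.snd_eq, Kernel.snd_prod, h, δ.disintegrate] at this
    rw [h]
    exact this.symm

end MultiSpecies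

/-! ### The quadratic form inequality that produces λ₀. -/

namespace MultiSpecies

lemma eta_le {n : ℕ} (m : Fin n → ℝ) (κ : Matrix (Fin n) (Fin n) ℝ) {i j : Fin n} (h : j ≠ i) :
    eta m κ i ≤ κ i j * m j :=
  ciInf_le (Set.finite_range fun j : {j : Fin n // j ≠ i} => κ i j * m j).bddBelow ⟨j, h⟩

lemma lambdaZero_le {n : ℕ} (m p : Fin n → ℝ) (κ : Matrix (Fin n) (Fin n) ℝ) (i : Fin n) :
    lambdaZero m p κ ≤ p i * min 0 (m i * κ i i - eta m κ i)
      + 1 / 2 * ∑ j, p j * (eta m κ j + eta m κ i * (m i / m j)) :=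
  ciInf_le (Set.finite_range _).bddBelow i

/-- The quadratic form inequality behind the convexity constant `λ₀`. -/
theorem lambdaZero_mul_le {n : ℕ} {E : Type*} [NormedAddCommGroup E] [InnerProductSpace ℝ E]
    {m p : Fin n → ℝ} (hm : ∀ j, 0 < m j)
    {κ : Matrix (Fin n) (Fin n) ℝ} (hκ : κ.IsSymm) {A : Fin n → ℝ} {B : Fin n → E}
    (hA : ∀ i, 0 ≤ A i) (hB : ∑ j, (1 / m j) • B j = 0)
    {D : Fin n → Fin n → ℝ} (hD : ∀ i j, D i j = p j * A i + p i * A j - 2 * inner ℝ (B i) (B j))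
    (hD0 : ∀ i j, 0 ≤ D i j) {lam : ℝ} (hlam : lam ≤ lambdaZero m p κ) :
    lam * ∑ j, 1 / m j * A j ≤ 1 / 2 * ∑ i, ∑ j, κ i j * D i j := by
  set η := eta m κ with hη
  have hDs (i j) : D i j = D j i := by rw [hD, hD, real_inner_comm]; ring
  -- Off the diagonal both η_i/m_j and, by symmetry of κ, η_j/m_i lie below κ_ij, hence so does
  -- their average. On the diagonal the correction term restores equality.
  have hpt (i j) : 1 / 2 * (η i / m j + η j / m i) * D i j
      + (if i = j then (κ i i - η i / m i) * D i i else 0) ≤ κ i j * D i j := by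
    split_ifs with h
    · subst h; apply le_of_eq; ring
    · rw [add_zero]
      refine mul_le_mul_of_nonneg_right ?_ (hD0 i j)
      have h1 : η i / m j ≤ κ i j := (div_le_iff₀ (hm j)).2 (eta_le m κ (Ne.symm h))
      have h2 : η j / m i ≤ κ i j := by
        rw [← hκ.apply i j]; exact (div_le_iff₀ (hm i)).2 (eta_le m κ h)
      linarith
  -- Since 0 ≤ D_ii ≤ 2 p_i A_i, the lower bound serves a nonnegative coefficient and the upper
  -- bound a negative one; this is the origin of the min(0, ·) in λ₀.
  have hdiag (i) : A i / m i * (p i * min 0 (m i * κ i i - η i))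
      ≤ 1 / 2 * ((κ i i - η i / m i) * D i i) := by
    have e : m i * κ i i - η i = m i * (κ i i - η i / m i) := by
      field_simp [(hm i).ne']
    have hDi : D i i = 2 * (p i * A i) - 2 * ‖B i‖ ^ 2 := by
      rw [hD, real_inner_self_eq_norm_sq]; ring
    have hN := sq_nonneg ‖B i‖
    have hm0 := (hm i).ne'
    have hD00 := hD0 i i
    rcases le_total 0 (κ i i - η i / m i) with h | h
    · rw [min_eq_left (by rw [e]; exact mul_nonneg (hm i).le h)]
      simp only [mul_zero]
      positivity
    · rw [min_eq_right (by rw [e]; exact mul_nonpos_of_nonneg_of_nonpos (hm i).le h), e]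
      have : A i / m i * (p i * (m i * (κ i i - η i / m i)))
          = (κ i i - η i / m i) * (p i * A i) := by field_simp
      rw [this, hDi]
      nlinarith
  -- The weight factors as η_i times 1/m_j, so the sum over j reproduces the centre-of-mass
  -- constraint.
  have hcross : ∑ i, ∑ j, η i / m j * inner ℝ (B i) (B j) = 0 := by
    refine Finset.sum_eq_zero fun i _ => ?_
    have : ∑ j, η i / m j * inner ℝ (B i) (B j) = η i * inner ℝ (B i) (∑ j, (1 / m j) • B j) := by
      rw [inner_sum, Finset.mul_sum]
      refine Finset.sum_congr rfl fun j _ => ?_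
      rw [real_inner_smul_right]; ring
    rw [this, hB, inner_zero_right, mul_zero]
  have hmain : ∑ i, ∑ j, 1 / 2 * (η i / m j + η j / m i) * D i j
      = ∑ i, A i / m i * ∑ j, p j * (η j + η i * (m i / m j)) := by
    have s1 : ∑ i, ∑ j, η j / m i * D i j = ∑ i, ∑ j, η i / m j * D i j := by
      rw [Finset.sum_comm]
      exact Finset.sum_congr rfl fun i _ => Finset.sum_congr rfl fun j _ => by rw [hDs]
    have s2 : ∑ i, ∑ j, η i / m j * (p i * A j) = ∑ i, ∑ j, η j / m i * (p j * A i) :=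
      Finset.sum_comm
    have s3 : ∑ i, ∑ j, η i / m j * D i j = ∑ i, ∑ j, η i / m j * (p j * A i)
        + ∑ i, ∑ j, η i / m j * (p i * A j) := by
      have : ∑ i, ∑ j, η i / m j * D i j = ∑ i, ∑ j, η i / m j * (p j * A i)
        + ∑ i, ∑ j, η i / m j * (p i * A j)
        - 2 * ∑ i, ∑ j, η i / m j * inner ℝ (B i) (B j) := by
        simp only [Finset.mul_sum, ← Finset.sum_add_distrib, ← Finset.sum_sub_distrib]
        refine Finset.sum_congr rfl fun i _ => Finset.sum_congr rfl fun j _ => ?_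
        rw [hD]; ring
      rw [this, hcross]; ring
    have s4 : ∑ i, ∑ j, 1 / 2 * (η i / m j + η j / m i) * D i j
        = 1 / 2 * (∑ i, ∑ j, η i / m j * D i j + ∑ i, ∑ j, η j / m i * D i j) := by
      simp only [Finset.mul_sum, ← Finset.sum_add_distrib]
      exact Finset.sum_congr rfl fun i _ => Finset.sum_congr rfl fun j _ => by ring
    rw [s4, s1, s3, s2]
    simp only [Finset.mul_sum, ← Finset.sum_add_distrib]
    refine Finset.sum_congr rfl fun i _ => Finset.sum_congr rfl fun j _ => ?_
    have h1 := (hm i).ne'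
    have h2 := (hm j).ne'
    field_simp
    ring
  calc lam * ∑ j, 1 / m j * A j
      ≤ ∑ i, A i / m i * (p i * min 0 (m i * κ i i - η i)
        + 1 / 2 * ∑ j, p j * (η j + η i * (m i / m j))) := by
        rw [Finset.mul_sum]
        refine Finset.sum_le_sum fun i _ => ?_
        have h1 : 0 ≤ A i / m i := div_nonneg (hA i) (hm i).le
        calc lam * (1 / m i * A i) = A i / m i * lam := by ring
          _ ≤ _ := mul_le_mul_of_nonneg_left (hlam.trans (lambdaZero_le m p κ i)) h1
    _ = ∑ i, A i / m i * (p i * min 0 (m i * κ i i - η i))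
        + 1 / 2 * ∑ i, ∑ j, 1 / 2 * (η i / m j + η j / m i) * D i j := by
        rw [hmain, Finset.mul_sum, ← Finset.sum_add_distrib]
        exact Finset.sum_congr rfl fun i _ => by ring
    _ ≤ ∑ i, 1 / 2 * ((κ i i - η i / m i) * D i i)
        + 1 / 2 * ∑ i, ∑ j, 1 / 2 * (η i / m j + η j / m i) * D i j := by
        gcongr ?_ + _
        exact Finset.sum_le_sum fun i _ => hdiag i
    _ = 1 / 2 * ∑ i, ∑ j, (1 / 2 * (η i / m j + η j / m i) * D i j
      + (if i = j then (κ i i - η i / m i) * D i i else 0)) := by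
        simp only [Finset.sum_add_distrib, Finset.sum_ite_eq, Finset.mem_univ, if_true,
          ← Finset.mul_sum]
        ring
    _ ≤ _ := by
        gcongr with i _ j _
        exact hpt i j

end MultiSpecies

/-! ### Integrated semi-convexity along interpolations, and conclusion. -/

namespace MultiSpecies

open ProbabilityTheory Filter Topology
open scoped ENNReal NNReal

lemma memLp_two_iff {Ω E : Type*} [MeasurableSpace Ω] [NormedAddCommGroup E] {P : Measure Ω}
    {f : Ω → E} (hf : AEStronglyMeasurable f P) :
    MemLp f 2 P ↔ ∫⁻ x, ‖f x‖ₑ ^ 2 ∂P < ⊤ := by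
  rw [MemLp, and_iff_right hf,
    eLpNorm_lt_top_iff_lintegral_rpow_enorm_lt_top two_ne_zero ENNReal.ofNat_ne_top]
  simp

lemma integral_linear_comb {Ω : Type*} [MeasurableSpace Ω] {P : Measure Ω} {f g h : Ω → ℝ}
    (hf : Integrable f P) (hg : Integrable g P) (hh : Integrable h P) (α β γ : ℝ) :
    ∫ x, (α * f x + β * g x - γ * h x) ∂P
      = α * ∫ x, f x ∂P + β * ∫ x, g x ∂P - γ * ∫ x, h x ∂P := by
  have e := integral_sub ((hf.const_mul α).add (hg.const_mul β)) (hh.const_mul γ)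
  have e' := integral_add (hf.const_mul α) (hg.const_mul β)
  simp only [Pi.add_apply] at e e'
  rw [e, e', integral_const_mul, integral_const_mul, integral_const_mul]

section ProductIntegrals

variable {Ω Ω' E : Type*} [MeasurableSpace Ω] [MeasurableSpace Ω'] [NormedAddCommGroup E]
  {P : Measure Ω} {Q : Measure Ω'} [IsFiniteMeasure P] [IsFiniteMeasure Q]
  {S : Ω → E} {T : Ω' → E}

lemma integrable_norm_sub_sq_prod (hS : MemLp S 2 P) (hT : MemLp T 2 Q) :
    Integrable (fun z : Ω × Ω' => ‖S z.1 - T z.2‖ ^ 2) (P.prod Q) := by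
  have h1 : MemLp (fun z : Ω × Ω' => S z.1) 2 (P.prod Q) := hS.comp_fst Q
  have h2 : MemLp (fun z : Ω × Ω' => T z.2) 2 (P.prod Q) := hT.comp_snd P
  exact (h1.sub h2).integrable_norm_pow two_ne_zero

lemma integrable_comp_sub_prod {f : E → ℝ} (hf : Continuous f) {C : ℝ}
    (hC : ∀ z, |f z| ≤ C * (1 + ‖z‖ ^ 2)) (hS : MemLp S 2 P) (hT : MemLp T 2 Q) :
    Integrable (fun z : Ω × Ω' => f (S z.1 - T z.2)) (P.prod Q) := by
  refine (((integrable_const (1 : ℝ)).add (integrable_norm_sub_sq_prod hS hT)).const_mul C).mono'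
    (hf.comp_aestronglyMeasurable (hS.1.comp_fst.sub hT.1.comp_snd)) (ae_of_all _ fun z => hC _)

lemma integral_norm_sub_sq_prod [InnerProductSpace ℝ E] [CompleteSpace E]
    (hS : MemLp S 2 P) (hT : MemLp T 2 Q) :
    ∫ z, ‖S z.1 - T z.2‖ ^ 2 ∂(P.prod Q) = Q.real Set.univ * ∫ x, ‖S x‖ ^ 2 ∂P
      + P.real Set.univ * ∫ y, ‖T y‖ ^ 2 ∂Q - 2 * inner ℝ (∫ x, S x ∂P) (∫ y, T y ∂Q) := by
  have iS : Integrable (fun x => ‖S x‖ ^ 2) P := hS.integrable_norm_pow two_ne_zero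
  have iT : Integrable (fun x => ‖T x‖ ^ 2) Q := hT.integrable_norm_pow two_ne_zero
  have jS : Integrable S P := hS.integrable one_le_two
  have jT : Integrable T Q := hT.integrable one_le_two
  rw [integral_prod _ (integrable_norm_sub_sq_prod hS hT)]
  have inner_int (x : Ω) : ∫ y, ‖S x - T y‖ ^ 2 ∂Q
      = Q.real Set.univ * ‖S x‖ ^ 2 + (∫ y, ‖T y‖ ^ 2 ∂Q) * 1
        - 2 * inner ℝ (∫ y, T y ∂Q) (S x) := by
    -- The factors 1 give the integrand the shape required by `integral_linear_comb`.
    have e (y) : ‖S x - T y‖ ^ 2 = ‖S x‖ ^ 2 * 1 + 1 * ‖T y‖ ^ 2 - 2 * inner ℝ (S x) (T y) := by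
      rw [norm_sub_sq_real]; ring
    simp_rw [e]
    rw [integral_linear_comb (integrable_const 1) iT (jT.const_inner (S x)), integral_const,
      integral_inner jT, real_inner_comm, smul_eq_mul]
    ring
  simp_rw [inner_int]
  rw [integral_linear_comb iS (integrable_const 1) (jS.const_inner _), integral_const,
    integral_inner jS, real_inner_comm, smul_eq_mul]
  ring

end ProductIntegrals

lemma le_of_convexOn_sub_sq {E : Type*} [NormedAddCommGroup E] [InnerProductSpace ℝ E]
    {f : E → ℝ} {k : ℝ} (hf : ConvexOn ℝ Set.univ fun z => f z - 1 / 2 * k * ‖z‖ ^ 2)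
    {s : ℝ} (hs : s ∈ Set.Icc (0 : ℝ) 1) (x y : E) :
    f ((1 - s) • x + s • y) ≤ (1 - s) * f x + s * f y
      - 1 / 2 * s * (1 - s) * (k * ‖y - x‖ ^ 2) := by
  have h := hf.2 (Set.mem_univ x) (Set.mem_univ y) (sub_nonneg.2 hs.2) hs.1 (by ring)
  simp only [smul_eq_mul] at h
  have e : ‖(1 - s) • x + s • y‖ ^ 2
      = (1 - s) * ‖x‖ ^ 2 + s * ‖y‖ ^ 2 - s * (1 - s) * ‖y - x‖ ^ 2 := by
    rw [norm_add_sq_real, norm_sub_sq_real, norm_smul, norm_smul, real_inner_smul_left,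
      real_inner_smul_right, mul_pow, mul_pow, Real.norm_eq_abs, Real.norm_eq_abs, sq_abs, sq_abs,
      real_inner_comm]
    ring
  rw [e] at h
  linarith

section InSpace

variable {n d : ℕ} {m p : Fin n → ℝ} {c : Rd d} {μ : VecMeasure n d}

lemma InSpace.isFiniteMeasure (h : InSpace m p c μ) (j : Fin n) : IsFiniteMeasure (μ j) :=
  ⟨by rw [h.mass]; exact ENNReal.ofReal_lt_top⟩

lemma InSpace.memLp_id (h : InSpace m p c μ) (j : Fin n) : MemLp (fun x : Rd d => x) 2 (μ j) :=
  (memLp_two_iff aestronglyMeasurable_id).2 (h.moment j)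

lemma InSpace.integrable {W : Rd d → Matrix (Fin n) (Fin n) ℝ} {κ : Matrix (Fin n) (Fin n) ℝ}
    (hW : IsInteractionPotential W κ) (h : InSpace m p c μ) (i j : Fin n) :
    Integrable (fun z : Rd d × Rd d => W (z.1 - z.2) i j) ((μ i).prod (μ j)) := by
  have := h.isFiniteMeasure
  obtain ⟨C, hC⟩ := hW.growth
  exact integrable_comp_sub_prod (f := fun z => W z i j) (hW.contDiff i j).continuous (hC i j)
    (h.memLp_id i) (h.memLp_id j)

/-- Transfers the energies of the endpoints and of the interpolant to the same product measures,
where their integrands can be compared pointwise. -/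
lemma InSpace.energy_eq {W : Rd d → Matrix (Fin n) (Fin n) ℝ} {κ : Matrix (Fin n) (Fin n) ℝ}
    (hW : IsInteractionPotential W κ) (h : InSpace m p c μ) {Ω : Type*} [MeasurableSpace Ω]
    {M : Fin n → Measure Ω} [∀ j, IsFiniteMeasure (M j)] {T : Ω → Rd d} (hT : Measurable T)
    (hM : ∀ j, (M j).map T = μ j) :
    energy W μ = 1 / 2 * ∑ i, ∑ j, ∫ z, W (T z.1 - T z.2) i j ∂((M i).prod (M j)) := by
  have := h.isFiniteMeasure
  rw [energy]
  congr 1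
  refine Finset.sum_congr rfl fun i _ => Finset.sum_congr rfl fun j _ => ?_
  have hi := h.integrable hW i j
  rw [← integral_prod_symm _ hi, ← hM i, ← hM j, Measure.map_prod_map _ _ hT hT,
    integral_map (hT.prodMap hT).aemeasurable]
  · rfl
  · rw [← Measure.map_prod_map _ _ hT hT, hM, hM]
    exact hi.1

end InSpace

theorem exists_multimarginal {d : ℕ} {μ₁ μ₂ μ₃ : Measure (Rd d)} [IsFiniteMeasure μ₁]
    [IsFiniteMeasure μ₂] [IsFiniteMeasure μ₃] (h₂ : μ₁ Set.univ = μ₂ Set.univ)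
    (h₃ : μ₁ Set.univ = μ₃ Set.univ) (h0 : μ₁ Set.univ ≠ 0) :
    ∃ M : Measure (Rd d × Rd d × Rd d),
      (M.map (fun x => x.1) = μ₁ ∧ M.map (fun x => x.2.1) = μ₂ ∧ M.map (fun x => x.2.2) = μ₃) ∧
      IsOptimalPlan μ₁ μ₂ (M.map (fun x => (x.1, x.2.1))) ∧
      IsOptimalPlan μ₁ μ₃ (M.map (fun x => (x.1, x.2.2))) := by
  obtain ⟨γ, hγ⟩ := exists_isOptimalPlan h₂ h0
  obtain ⟨δ, hδ⟩ := exists_isOptimalPlan h₃ h0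
  have : IsFiniteMeasure γ :=
    ⟨by rw [measure_univ_of_mem_couplings hγ.1]; exact measure_lt_top _ _⟩
  have : IsFiniteMeasure δ :=
    ⟨by rw [measure_univ_of_mem_couplings hδ.1]; exact measure_lt_top _ _⟩
  obtain ⟨M, hM₂, hM₃⟩ := exists_gluing γ δ (hγ.1.1.trans hδ.1.1.symm)
  refine ⟨M, ⟨?_, ?_, ?_⟩, by rwa [hM₂], by rwa [hM₃]⟩
  · rw [← hγ.1.1, ← hM₂, Measure.map_map measurable_fst (by fun_prop)]; rfl
  · rw [← hγ.1.2, ← hM₂, Measure.map_map measurable_snd (by fun_prop)]; rfl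
  · rw [← hδ.1.2, ← hM₃, Measure.map_map measurable_snd (by fun_prop)]; rfl

section Interpolation

variable {n d : ℕ} {m p : Fin n → ℝ} {c : Rd d} {μ ν : VecMeasure n d}
  {Ω : Type*} [MeasurableSpace Ω] {M : Fin n → Measure Ω} {a b : Ω → Rd d}

lemma InSpace.memLp_of_map (h : InSpace m p c μ) (ha : Measurable a)
    (hM : ∀ j, (M j).map a = μ j) (j : Fin n) : MemLp a 2 (M j) :=
  (memLp_map_measure_iff aestronglyMeasurable_id ha.aemeasurable).1
    (by rw [hM]; exact h.memLp_id j)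

lemma InSpace.sum_integral_of_map (h : InSpace m p c μ) (ha : Measurable a)
    (hM : ∀ j, (M j).map a = μ j) : ∑ j, (1 / m j) • ∫ x, a x ∂(M j) = c := by
  rw [← h.center]
  refine Finset.sum_congr rfl fun j _ => ?_
  rw [← hM j, integral_map (f := fun x => x) ha.aemeasurable aestronglyMeasurable_id]

/-- Pushforward keeps the mass, L² is a vector space, and the centre of mass is affine in s with the
same value at both ends. -/
lemma InSpace.interpolate (hμ : InSpace m p c μ) (hν : InSpace m p c ν)
    [∀ j, IsFiniteMeasure (M j)] (ha : Measurable a) (hb : Measurable b)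
    (hMa : ∀ j, (M j).map a = μ j) (hMb : ∀ j, (M j).map b = ν j) (s : ℝ) :
    InSpace m p c (fun j => (M j).map fun x => (1 - s) • a x + s • b x) := by
  have hT : Measurable fun x => (1 - s) • a x + s • b x := by fun_prop
  have La := hμ.memLp_of_map ha hMa
  have Lb := hν.memLp_of_map hb hMb
  have LT (j) : MemLp (fun x => (1 - s) • a x + s • b x) 2 (M j) :=
    ((La j).const_smul (1 - s)).add ((Lb j).const_smul s)
  refine ⟨fun j => ?_, fun j => ?_, ?_⟩
  · rw [Measure.map_apply hT MeasurableSet.univ, ← hμ.mass j, ← hMa j,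
      Measure.map_apply ha MeasurableSet.univ, Set.preimage_univ, Set.preimage_univ]
  · rw [lintegral_map (by fun_prop) hT]
    exact (memLp_two_iff (LT j).1).1 (LT j)
  · have e (j) : ∫ x, x ∂((M j).map fun x => (1 - s) • a x + s • b x)
        = (1 - s) • ∫ x, a x ∂(M j) + s • ∫ x, b x ∂(M j) := by
      rw [integral_map (f := fun x => x) hT.aemeasurable aestronglyMeasurable_id,
        integral_add (f := fun x => (1 - s) • a x) (g := fun x => s • b x)
          (((La j).integrable one_le_two).smul (1 - s))
          (((Lb j).integrable one_le_two).smul s), integral_smul, integral_smul]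
    simp_rw [e, smul_add, Finset.sum_add_distrib, smul_comm _ (1 - s), smul_comm _ s,
      ← Finset.smul_sum]
    rw [hμ.sum_integral_of_map ha hMa, hν.sum_integral_of_map hb hMb, ← add_smul, sub_add_cancel,
      one_smul]

/-- Integrated semi-convexity of the interaction energy along an interpolation of two maps. -/
theorem energy_interpolate_le {W : Rd d → Matrix (Fin n) (Fin n) ℝ}
    {κ : Matrix (Fin n) (Fin n) ℝ} (hW : IsInteractionPotential W κ)
    (hμ : InSpace m p c μ) (hν : InSpace m p c ν)
    [∀ j, IsFiniteMeasure (M j)] (ha : Measurable a) (hb : Measurable b)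
    (hMa : ∀ j, (M j).map a = μ j) (hMb : ∀ j, (M j).map b = ν j)
    {s : ℝ} (hs : s ∈ Set.Icc (0 : ℝ) 1) :
    energy W (fun j => (M j).map fun x => (1 - s) • a x + s • b x)
      ≤ (1 - s) * energy W μ + s * energy W ν - 1 / 2 * s * (1 - s) * (1 / 2 * ∑ i, ∑ j,
        κ i j * ∫ z, ‖(b z.1 - a z.1) - (b z.2 - a z.2)‖ ^ 2 ∂((M i).prod (M j))) := by
  have hT : Measurable fun x => (1 - s) • a x + s • b x := by fun_prop
  have La := hμ.memLp_of_map ha hMa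
  have Lb := hν.memLp_of_map hb hMb
  have LT (j) : MemLp (fun x => (1 - s) • a x + s • b x) 2 (M j) :=
    ((La j).const_smul (1 - s)).add ((Lb j).const_smul s)
  rw [(hμ.interpolate hν ha hb hMa hMb s).energy_eq hW hT fun _ => rfl,
    hμ.energy_eq hW ha hMa, hν.energy_eq hW hb hMb]
  simp only [Finset.mul_sum, ← Finset.sum_add_distrib, ← Finset.sum_sub_distrib]
  refine Finset.sum_le_sum fun i _ => Finset.sum_le_sum fun j _ => ?_
  obtain ⟨C, hC⟩ := hW.growth
  have hc := (hW.contDiff i j).continuous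
  have Ia := integrable_comp_sub_prod hc (hC i j) (La i) (La j)
  have Ib := integrable_comp_sub_prod hc (hC i j) (Lb i) (Lb j)
  have IT := integrable_comp_sub_prod hc (hC i j) (LT i) (LT j)
  have Iu := integrable_norm_sub_sq_prod ((Lb i).sub (La i)) ((Lb j).sub (La j))
  have key : ∫ z, W ((1 - s) • a z.1 + s • b z.1 - ((1 - s) • a z.2 + s • b z.2)) i j
        ∂((M i).prod (M j))
      ≤ ∫ z, ((1 - s) * W (a z.1 - a z.2) i j + s * W (b z.1 - b z.2) i j
        - 1 / 2 * s * (1 - s) * κ i j * ‖(b z.1 - a z.1) - (b z.2 - a z.2)‖ ^ 2)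
        ∂((M i).prod (M j)) := by
    refine integral_mono IT (((Ia.const_mul (1 - s)).add (Ib.const_mul s)).sub
      (Iu.const_mul (1 / 2 * s * (1 - s) * κ i j))) fun z => ?_
    -- Differences of interpolated points are interpolations of differences, so semi-convexity
    -- applies on the segment joining these two vectors.
    have := le_of_convexOn_sub_sq (hW.semiconvex i j) hs (a z.1 - a z.2) (b z.1 - b z.2)
    have e1 : (1 - s) • (a z.1 - a z.2) + s • (b z.1 - b z.2)
      = ((1 - s) • a z.1 + s • b z.1) - ((1 - s) • a z.2 + s • b z.2) := by module
    have e2 : b z.1 - b z.2 - (a z.1 - a z.2) = (b z.1 - a z.1) - (b z.2 - a z.2) := by abel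
    rw [e1, e2, ← mul_assoc] at this
    exact this
  have lin := integral_linear_comb Ia Ib Iu (1 - s) s (1 / 2 * s * (1 - s) * κ i j)
  simp only [Pi.sub_apply] at lin
  rw [lin] at key
  linarith

end Interpolation

/-- `λ`-convexity of the interaction energy along generalized geodesics. -/
theorem convexAlongGenGeodesics_energy {n d : ℕ} {m p : Fin n → ℝ} (hm : ∀ j, 0 < m j)
    (hp : ∀ j, 0 < p j) (c : Rd d) {W : Rd d → Matrix (Fin n) (Fin n) ℝ}
    {κ : Matrix (Fin n) (Fin n) ℝ} (hW : IsInteractionPotential W κ) {lam : ℝ}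
    (hlam : lam ≤ lambdaZero m p κ) : ConvexAlongGenGeodesics m p c lam (energy W) := by
  intro μ₁ μ₂ μ₃ h₁ h₂ h₃
  have := h₁.isFiniteMeasure
  have := h₂.isFiniteMeasure
  have := h₃.isFiniteMeasure
  choose M hM hopt using fun j => exists_multimarginal (μ₁ := μ₁ j) (μ₂ := μ₂ j) (μ₃ := μ₃ j)
    (by rw [h₁.mass, h₂.mass]) (by rw [h₁.mass, h₃.mass])
    -- Positive mass allows the product measure to be normalized into a plan, so the set of
    -- couplings is nonempty.
    (by rw [h₁.mass]; exact (ENNReal.ofReal_pos.2 (hp j)).ne')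
  have hmass (j) : M j Set.univ = ENNReal.ofReal (p j) := by
    rw [← h₁.mass j, ← (hM j).1, Measure.map_apply measurable_fst MeasurableSet.univ,
      Set.preimage_univ]
  have hfin (j) : IsFiniteMeasure (M j) := ⟨by rw [hmass]; exact ENNReal.ofReal_lt_top⟩
  have hreal (j) : (M j).real Set.univ = p j := by
    rw [measureReal_def, hmass, ENNReal.toReal_ofReal (hp j).le]
  have ha : Measurable fun x : Rd d × Rd d × Rd d => x.2.1 := by fun_prop
  have hb : Measurable fun x : Rd d × Rd d × Rd d => x.2.2 := by fun_prop
  have hMa := fun j => (hM j).2.1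
  have hMb := fun j => (hM j).2.2
  refine ⟨M, hM, hopt, fun s hs => ⟨h₂.interpolate h₃ ha hb hMa hMb s,
    (energy_interpolate_le hW h₂ h₃ ha hb hMa hMb hs).trans ?_⟩⟩
  have La := h₂.memLp_of_map ha hMa
  have Lb := h₃.memLp_of_map hb hMb
  have Lu (j) : MemLp (fun x : Rd d × Rd d × Rd d => x.2.2 - x.2.1) 2 (M j) := (Lb j).sub (La j)
  have hB : ∑ j, (1 / m j) • ∫ x, (x.2.2 - x.2.1) ∂(M j) = 0 := by
    have e (j) : ∫ x, (x.2.2 - x.2.1) ∂(M j) = ∫ x, x.2.2 ∂(M j) - ∫ x, x.2.1 ∂(M j) :=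
      integral_sub ((Lb j).integrable one_le_two) ((La j).integrable one_le_two)
    simp_rw [e, smul_sub, Finset.sum_sub_distrib]
    rw [h₂.sum_integral_of_map ha hMa, h₃.sum_integral_of_map hb hMb, sub_self]
  have key := lambdaZero_mul_le hm hW.kappa_symm
    (A := fun j => ∫ x, ‖x.2.2 - x.2.1‖ ^ 2 ∂(M j))
    (D := fun i j => ∫ z, ‖(z.1.2.2 - z.1.2.1) - (z.2.2.2 - z.2.2.1)‖ ^ 2 ∂((M i).prod (M j)))
    (fun i => integral_nonneg fun x => sq_nonneg _) hB
    (fun i j => by rw [integral_norm_sub_sq_prod (Lu i) (Lu j), hreal, hreal])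
    (fun i j => integral_nonneg fun x => sq_nonneg _) hlam
  have hs' : 0 ≤ 1 / 2 * s * (1 - s) :=
    mul_nonneg (mul_nonneg (by norm_num) hs.1) (sub_nonneg.2 hs.2)
  have := mul_le_mul_of_nonneg_left key hs'
  linarith

end MultiSpecies

theorem theorem2p5 (n d : ℕ) (hn : 1 < n)
    (m p : Fin n → ℝ) (hm : ∀ j, 0 < m j) (hp : ∀ j, 0 < p j)
    (c : MultiSpecies.Rd d)
    (W : MultiSpecies.Rd d → Matrix (Fin n) (Fin n) ℝ)
    (κ : Matrix (Fin n) (Fin n) ℝ)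
    (hW : MultiSpecies.IsInteractionPotential W κ)
    (hirr : MultiSpecies.Irreducible W) :
    (∀ μ : MultiSpecies.VecMeasure n d, MultiSpecies.InSpace m p c μ →
      ∀ i j, Integrable (fun z : MultiSpecies.Rd d × MultiSpecies.Rd d => W (z.1 - z.2) i j)
        ((μ i).prod (μ j))) ∧
    ∀ lam : ℝ, lam ≤ MultiSpecies.lambdaZero m p κ →
      MultiSpecies.ConvexAlongGenGeodesics m p c lam (MultiSpecies.energy W) := by
  exact ⟨fun μ hμ => hμ.integrable hW, fun lam hlam =>
    MultiSpecies.convexAlongGenGeodesics_energy hm hp c hW hlam⟩
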